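/- Let $n\ge 2$, and let $B_n$ be the braid group on $n$ strands with Artin generators $\sigma_1,\dots,\sigma_{n-1}$. For $1\le i<j\le n$ let $$a_{ij}=(\sigma_{j-1}\sigma_{j-2}\cdots\sigma_{i+1})\,\sigma_i\,(\sigma_{j-1}\sigma_{j-2}\cdots\sigma_{i+1})^{-1}$$ be the band generators (positive bands; their inverses are the negative bands), let $\delta=\sigma_{n-1}\sigma_{n-2}\cdots\sigma_1$, and let $B_n^+\subset B_n$ be the submonoid generated by all $a_{ij}$. For $V,W\in B_n$ write $V\le W$ if $W=PVQ$ for some $P,Q\in B_n^+$. For $\beta\in B_n$ let $$\inf(\beta)=\max\{r\in\mathbb Z\mid \delta^r\le\beta\},\qquad \sup(\beta)=\min\{s\in\mathbb Z\mid \beta\le\delta^s\},$$ and let $\mathrm{nb}(\beta)$ be the minimal number $k$ such that $\beta$ is represented by a word in the $a_{ij}^{\pm1}$ that contains exactly $k$ negative bands. Then, for every $\beta\in B_n$, the maximum and the two minima exist, and if $\inf(\beta)<0$, then $$\mathrm{nb}(\beta)\le (n-2)\,|\inf(\beta)|-\min\{0,\sup(\beta)\}.$$ Moreover, for $n=3$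 equality holds: if $\beta\in B_3$ and $\inf(\beta)<0$, then $$\mathrm{nb}(\beta)=|\inf(\beta)|-\min\{0,\sup(\beta)\}.$$ -/

import Mathlib

namespace BKL

/-- Artin's relations on the generators `σ_0, …, σ_{n-2}` (strands are numbered `0, …, n-1`, and
`σ_k` exchanges the strands `k` and `k+1`): `σ_i σ_j = σ_j σ_i` for `|i - j| ≥ 2` and
`σ_i σ_{i+1} σ_i = σ_{i+1} σ_i σ_{i+1}`. -/
def artinRels (n : ℕ) : Set (FreeGroup (Fin (n - 1))) :=
  {x | ∃ i j : Fin (n - 1), (i : ℕ) + 2 ≤ j ∧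
      x = FreeGroup.of i * FreeGroup.of j * (FreeGroup.of j * FreeGroup.of i)⁻¹} ∪
  {x | ∃ i j : Fin (n - 1), (i : ℕ) + 1 = j ∧
      x = FreeGroup.of i * FreeGroup.of j * FreeGroup.of i *
        (FreeGroup.of j * FreeGroup.of i * FreeGroup.of j)⁻¹}

/-- The braid group `B_n` on `n` strands. -/
abbrev BraidGroup (n : ℕ) : Type := PresentedGroup (artinRels n)

/-- The Artin generator `σ_k`, which exists for `k + 1 < n` (and is set to `1` otherwise, a value
that is used nowhere below). -/
def sigma (n k : ℕ) : BraidGroup n :=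
  if h : k < n - 1 then PresentedGroup.of ⟨k, h⟩ else 1

/-- The descending product `σ_{j-1} σ_{j-2} ⋯ σ_i`; it is `1` if `j ≤ i`. -/
def descProd (n i j : ℕ) : BraidGroup n :=
  ((List.range' i (j - i)).reverse.map (sigma n)).prod

/-- Index set of the band generators: the pairs `i < j` of strands. -/
abbrev BandIndex (n : ℕ) : Type := {p : Fin n × Fin n // p.1 < p.2}

/-- The band generator
`a_{ij} = (σ_{j-1} σ_{j-2} ⋯ σ_{i+1}) σ_i (σ_{j-1} σ_{j-2} ⋯ σ_{i+1})⁻¹`, `i < j`. -/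
def band {n : ℕ} (p : BandIndex n) : BraidGroup n :=
  descProd n (p.1.1 + 1) p.1.2 * sigma n p.1.1 * (descProd n (p.1.1 + 1) p.1.2)⁻¹

/-- The fundamental element `δ = σ_{n-1} ⋯ σ_2 σ_1` (numbering of the generators from `1`), that is
`a_{n-1,n} ⋯ a_{2,3} a_{1,2}`. -/
def delta (n : ℕ) : BraidGroup n := descProd n 0 (n - 1)

/-- The monoid `B_n^+` of positive braids: those represented by a (possibly empty) word in the
positive bands. -/
def positiveMonoid (n : ℕ) : Submonoid (BraidGroup n) := Submonoid.closure (Set.range band)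

/-- The relation `V ≤ W` on `B_n`: `W = P V Q` for some positive `P`, `Q`. -/
def braidLE {n : ℕ} (V W : BraidGroup n) : Prop :=
  ∃ P ∈ positiveMonoid n, ∃ Q ∈ positiveMonoid n, W = P * V * Q

/-- The set `{r ∈ ℤ ∣ δ^r ≤ β}`. -/
def infSet {n : ℕ} (β : BraidGroup n) : Set ℤ := {r | braidLE (delta n ^ r) β}

/-- The set `{s ∈ ℤ ∣ β ≤ δ^s}`. -/
def supSet {n : ℕ} (β : BraidGroup n) : Set ℤ := {s | braidLE β (delta n ^ s)}

/-- `inf(β) = max {r ∈ ℤ ∣ δ^r ≤ β}`. -/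
noncomputable def braidInf {n : ℕ} (β : BraidGroup n) : ℤ := sSup (infSet β)

/-- `sup(β) = min {s ∈ ℤ ∣ β ≤ δ^s}`. -/
noncomputable def braidSup {n : ℕ} (β : BraidGroup n) : ℤ := sInf (supSet β)

/-- Words in the band generators and their inverses: the letter `(p, true)` is the positive band
`a_p`, the letter `(p, false)` is the negative band `a_p⁻¹`. -/
abbrev BandWord (n : ℕ) : Type := List (BandIndex n × Bool)

/-- The braid represented by a word in the band generators. -/
def BandWord.eval {n : ℕ} (w : BandWord n) : BraidGroup n :=
  (w.map fun x => if x.2 = true then band x.1 else (band x.1)⁻¹).prod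

/-- The number of negative bands in a word. -/
def BandWord.negCount {n : ℕ} (w : BandWord n) : ℕ := w.countP fun x => !x.2

/-- The numbers `k` such that `β` is represented by a word in band generators that contains exactly
`k` negative bands. -/
def nbSet {n : ℕ} (β : BraidGroup n) : Set ℕ :=
  {k | ∃ w : BandWord n, BandWord.eval w = β ∧ BandWord.negCount w = k}

/-- The negative band number `nb(β)`, the least element of `nbSet β`. -/
noncomputable def nb {n : ℕ} (β : BraidGroup n) : ℕ := sInf (nbSet β)

end BKL

/-! Conjugation by `δ` permutes the bands, and every band divides `δ` on both sides with positive
quotient. Hence powers of `δ` move freely past positive braids, and with `r = -inf(β)` one has `β =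
δ^(-r) P`, `P` positive of some length `m`. Each `δ⁻¹` can swallow one band of `P`, leaving the
inverse of a positive word of length `n - 2`. If `P` runs out, each remaining `δ⁻¹` costs `n - 1`
negative bands. The total `r (n - 2) + max(0, r - m)` gives the bound because `sup(β) ≤ m - r`
(`exists_mem_nbSet_le`, `nb_le`).

For the lower bound, a word with `k` negative bands gives `inf(β) ≥ -k` (`neg_mem_infSet`) and
exponent sum at least `-k` (`neg_le_exponent`). In `B_3` the exponent sum is at most `inf(β) +
sup(β)` (`exponent_le_braidInf_add_braidSup`), so `k ≥ -inf(β) - sup(β)` as well. That inequality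
comes from normal forms `δ^k w`, on which `B_3` acts so that positive braids never lower `k + |w|`.
-/

namespace BKL

/-! ### Artin's relations -/

section Relations

variable {n : ℕ}

theorem sigma_of_lt {k : ℕ} (h : k < n - 1) :
    sigma n k = PresentedGroup.of (rels := artinRels n) ⟨k, h⟩ := by
  simp [sigma, h]

theorem sigma_comm {i j : ℕ} (h : i + 2 ≤ j) : sigma n i * sigma n j = sigma n j * sigma n i := by
  by_cases hj : j < n - 1
  · have hi : i < n - 1 := by omega
    rw [sigma_of_lt hi, sigma_of_lt hj]
    have := PresentedGroup.one_of_mem (rels := artinRels n)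
      (x := FreeGroup.of ⟨i, hi⟩ * FreeGroup.of ⟨j, hj⟩ *
        (FreeGroup.of ⟨j, hj⟩ * FreeGroup.of ⟨i, hi⟩)⁻¹) (Or.inl ⟨⟨i, hi⟩, ⟨j, hj⟩, h, rfl⟩)
    rw [map_mul, map_inv, mul_inv_eq_one, map_mul, map_mul] at this
    exact this
  · simp [sigma, hj]

theorem sigma_braid {i : ℕ} (h : i + 2 < n) :
    sigma n i * sigma n (i + 1) * sigma n i = sigma n (i + 1) * sigma n i * sigma n (i + 1) := by
  have hi : i < n - 1 := by omega
  have hj : i + 1 < n - 1 := by omega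
  rw [sigma_of_lt hi, sigma_of_lt hj]
  have := PresentedGroup.one_of_mem (rels := artinRels n)
    (x := FreeGroup.of ⟨i, hi⟩ * FreeGroup.of ⟨i + 1, hj⟩ * FreeGroup.of ⟨i, hi⟩ *
      (FreeGroup.of ⟨i + 1, hj⟩ * FreeGroup.of ⟨i, hi⟩ * FreeGroup.of ⟨i + 1, hj⟩)⁻¹)
    (Or.inr ⟨⟨i, hi⟩, ⟨i + 1, hj⟩, rfl, rfl⟩)
  rw [map_mul, map_inv, mul_inv_eq_one] at this
  simp only [map_mul] at this
  exact this

/-! ### Descending products -/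

theorem descProd_of_le {i j : ℕ} (h : j ≤ i) : descProd n i j = 1 := by
  simp [descProd, Nat.sub_eq_zero_of_le h]

theorem descProd_succ {i j : ℕ} (h : i ≤ j) :
    descProd n i (j + 1) = sigma n j * descProd n i j := by
  have h1 : j + 1 - i = (j - i) + 1 := by omega
  have h2 : i + (j - i) = j := by omega
  simp [descProd, h1, List.range'_concat, h2]

theorem descProd_mul {i j k : ℕ} (hij : i ≤ j) (hjk : j ≤ k) :
    descProd n j k * descProd n i j = descProd n i k := by
  induction k, hjk using Nat.le_induction with
  | base => simp [descProd_of_le]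
  | succ k hk ih => rw [descProd_succ hk, descProd_succ (hij.trans hk), mul_assoc, ih]

theorem descProd_self_succ (i : ℕ) : descProd n i (i + 1) = sigma n i := by
  simp [descProd_succ, descProd_of_le]

theorem sigma_comm_descProd_right {i j k : ℕ} (h : i + 2 ≤ j) :
    sigma n i * descProd n j k = descProd n j k * sigma n i := by
  rcases le_total k j with hk | hk
  · simp [descProd_of_le hk]
  induction k, hk using Nat.le_induction with
  | base => simp [descProd_of_le]
  | succ k hk ih =>
    rw [descProd_succ hk, ← mul_assoc, sigma_comm (by omega), mul_assoc, ih, mul_assoc]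

theorem sigma_comm_descProd_left {i j k : ℕ} (h : k < i) :
    sigma n i * descProd n j k = descProd n j k * sigma n i := by
  rcases le_total k j with hk | hk
  · simp [descProd_of_le hk]
  induction k, hk using Nat.le_induction with
  | base => simp [descProd_of_le]
  | succ k hk ih =>
    rw [descProd_succ hk, ← mul_assoc, ← sigma_comm (by omega), mul_assoc, ih (by omega), mul_assoc]

/-- Only the factor `σ_{i+1} σ_i` of `δ` interacts with the letter: the braid relation turns
`σ_{i+1}` into `σ_i` there, and the other factors commute with it. -/
theorem delta_mul_sigma {i : ℕ} (h : i + 2 < n) :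
    delta n * sigma n (i + 1) = sigma n i * delta n := by
  have hd : delta n = descProd n (i + 2) (n - 1) * (sigma n (i + 1) * sigma n i * descProd n 0 i) := by
    rw [delta, ← descProd_mul (i := 0) (j := i + 2) (by omega) (by omega),
      descProd_succ (by omega), descProd_succ (by omega), mul_assoc (sigma n (i + 1))]
  calc delta n * sigma n (i + 1)
      = descProd n (i + 2) (n - 1) * (sigma n (i + 1) * sigma n i *
          (descProd n 0 i * sigma n (i + 1))) := by rw [hd]; group
    _ = descProd n (i + 2) (n - 1) * (sigma n (i + 1) * sigma n i * sigma n (i + 1)) *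
          descProd n 0 i := by rw [← sigma_comm_descProd_left (by omega)]; group
    _ = (descProd n (i + 2) (n - 1) * sigma n i) * (sigma n (i + 1) * sigma n i) *
          descProd n 0 i := by rw [← sigma_braid h]; group
    _ = sigma n i * delta n := by rw [← sigma_comm_descProd_right (by omega), hd]; group

theorem delta_mul_descProd {i j : ℕ} (hj : j + 1 < n) :
    delta n * descProd n (i + 1) (j + 1) = descProd n i j * delta n := by
  rcases le_total j i with hk | hk
  · simp [descProd_of_le hk, descProd_of_le (Nat.succ_le_succ hk)]
  induction j, hk using Nat.le_induction with
  | base => simp [descProd_of_le]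
  | succ j hk ih =>
    rw [descProd_succ (by omega), ← mul_assoc, delta_mul_sigma (by omega), mul_assoc,
      ih (by omega), descProd_succ hk, mul_assoc]

/-! ### Bands and conjugation by `δ` -/

/-- The band generator `a_{ij}` with natural number indices. -/
def natBand (n i j : ℕ) : BraidGroup n :=
  descProd n (i + 1) j * sigma n i * (descProd n (i + 1) j)⁻¹

theorem natBand_mem_range {i j : ℕ} (hij : i < j) (hj : j < n) :
    natBand n i j ∈ Set.range (band (n := n)) :=
  ⟨⟨(⟨i, hij.trans hj⟩, ⟨j, hj⟩), hij⟩, rfl⟩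

theorem sigma_eq_natBand (i : ℕ) : sigma n i = natBand n i (i + 1) := by
  simp [natBand, descProd_of_le]

theorem sigma_mul_natBand {i j : ℕ} (hij : i + 1 < j) (hj : j < n) :
    sigma n i * natBand n i j = natBand n (i + 1) j * sigma n i := by
  have hd : descProd n (i + 1) j = descProd n (i + 2) j * sigma n (i + 1) := by
    rw [← descProd_self_succ, descProd_mul (by omega) (by omega)]
  have hb : sigma n i * (sigma n (i + 1) * sigma n i * (sigma n (i + 1))⁻¹) =
      sigma n (i + 1) * sigma n i := by
    rw [← mul_assoc, ← mul_assoc, sigma_braid (by omega)]; group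
  have hc : (descProd n (i + 2) j)⁻¹ * sigma n i = sigma n i * (descProd n (i + 2) j)⁻¹ :=
    ((Commute.inv_right (sigma_comm_descProd_right (n := n) (k := j) le_rfl)).eq).symm
  calc sigma n i * natBand n i j
      = (sigma n i * descProd n (i + 2) j) * (sigma n (i + 1) * sigma n i * (sigma n (i + 1))⁻¹)
          * (descProd n (i + 2) j)⁻¹ := by rw [natBand, hd]; group
    _ = descProd n (i + 2) j *
          (sigma n i * (sigma n (i + 1) * sigma n i * (sigma n (i + 1))⁻¹))
          * (descProd n (i + 2) j)⁻¹ := by rw [sigma_comm_descProd_right le_rfl]; group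
    _ = descProd n (i + 2) j * sigma n (i + 1) * (sigma n i * (descProd n (i + 2) j)⁻¹) := by
          rw [hb]; group
    _ = natBand n (i + 1) j * sigma n i := by rw [← hc, natBand]; group

theorem descProd_mul_natBand {i j : ℕ} (hij : i < j) (hj : j < n) :
    descProd n 0 i * natBand n 0 j = natBand n i j * descProd n 0 i := by
  induction i with
  | zero => simp [descProd_of_le]
  | succ i ih =>
    rw [descProd_succ (by omega), mul_assoc, ih (by omega), ← mul_assoc, sigma_mul_natBand hij hj,
      mul_assoc]

theorem delta_mul_natBand_succ {i j : ℕ} (hij : i < j) (hj : j + 1 < n) :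
    delta n * natBand n (i + 1) (j + 1) = natBand n i j * delta n := by
  have h := delta_mul_descProd (i := i + 1) hj
  calc delta n * natBand n (i + 1) (j + 1)
      = (delta n * descProd n (i + 2) (j + 1)) * sigma n (i + 1)
          * (descProd n (i + 2) (j + 1))⁻¹ := by rw [natBand]; group
    _ = descProd n (i + 1) j * (sigma n i * delta n) * (descProd n (i + 2) (j + 1))⁻¹ := by
        rw [h, mul_assoc (descProd n (i + 1) j), delta_mul_sigma (by omega)]
    _ = descProd n (i + 1) j * sigma n i * (descProd n (i + 1) j)⁻¹ *
          (descProd n (i + 1) j * delta n) * (descProd n (i + 2) (j + 1))⁻¹ := by group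
    _ = natBand n i j * delta n := by rw [← h, natBand]; group

theorem delta_eq_descProd_mul_sigma (hn : 2 ≤ n) :
    delta n = descProd n 1 (n - 1) * sigma n 0 := by
  rw [delta, ← descProd_mul (j := 1) (by omega) (by omega), descProd_self_succ]

/-- The wrap-around case: `δ` lowers strand indices by one modulo `n`, so strand `0` becomes `n - 1`
and the pair changes order. -/
theorem delta_mul_natBand_zero {i : ℕ} (hi : i + 1 < n) :
    delta n * natBand n 0 (i + 1) = natBand n i (n - 1) * delta n := by
  have h0 : delta n * sigma n 0 = natBand n 0 (n - 1) * delta n := by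
    rw [delta_eq_descProd_mul_sigma (by omega), natBand]; group
  have h := delta_mul_descProd (i := 0) hi
  calc delta n * natBand n 0 (i + 1)
      = (delta n * descProd n 1 (i + 1)) * sigma n 0 * (descProd n 1 (i + 1))⁻¹ := by
        rw [natBand]; group
    _ = (descProd n 0 i * natBand n 0 (n - 1)) * delta n * (descProd n 1 (i + 1))⁻¹ := by
        rw [h, mul_assoc (descProd n 0 i), h0]; group
    _ = natBand n i (n - 1) * (delta n * descProd n 1 (i + 1)) * (descProd n 1 (i + 1))⁻¹ := by
        rw [descProd_mul_natBand (by omega) (by omega), h]; group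
    _ = natBand n i (n - 1) * delta n := by group

theorem delta_conj_band (p : BandIndex n) :
    delta n * band p * (delta n)⁻¹ ∈ Set.range (band (n := n)) := by
  obtain ⟨⟨⟨i, hi⟩, ⟨j, hj⟩⟩, hij⟩ := p
  change delta n * natBand n i j * (delta n)⁻¹ ∈ _
  replace hij : i < j := hij
  obtain ⟨j, rfl⟩ : ∃ m, j = m + 1 := ⟨j - 1, by omega⟩
  cases i with
  | zero =>
    rw [delta_mul_natBand_zero hj, mul_inv_cancel_right]
    exact natBand_mem_range (by omega) (by omega)
  | succ i =>
    rw [delta_mul_natBand_succ (by omega) hj, mul_inv_cancel_right]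
    exact natBand_mem_range (by omega) (by omega)

theorem delta_inv_conj_band (p : BandIndex n) :
    (delta n)⁻¹ * band p * delta n ∈ Set.range (band (n := n)) := by
  obtain ⟨⟨⟨i, hi⟩, ⟨j, hj⟩⟩, hij⟩ := p
  change (delta n)⁻¹ * natBand n i j * delta n ∈ _
  replace hij : i < j := hij
  rw [mul_assoc]
  by_cases h : j + 1 < n
  · rw [← delta_mul_natBand_succ hij h, inv_mul_cancel_left]
    exact natBand_mem_range (by omega) (by omega)
  · obtain rfl : j = n - 1 := by omega
    rw [← delta_mul_natBand_zero (by omega), inv_mul_cancel_left]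
    exact natBand_mem_range (by omega) (by omega)

/-! ### Exponent sum and the positive monoid -/

/-- The exponent sum `B_n → ℤ`. -/
def expSum (n : ℕ) : BraidGroup n →* Multiplicative ℤ :=
  PresentedGroup.toGroup (f := fun _ => Multiplicative.ofAdd 1) (by
    rintro r (⟨i, j, -, rfl⟩ | ⟨i, j, -, rfl⟩) <;> simp)

/-- The exponent sum as an integer. -/
def exponent (β : BraidGroup n) : ℤ := (expSum n β).toAdd

@[simp] theorem exponent_one : exponent (1 : BraidGroup n) = 0 := by simp [exponent]

@[simp] theorem exponent_mul (α β : BraidGroup n) :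
    exponent (α * β) = exponent α + exponent β := by simp [exponent]

@[simp] theorem exponent_inv (β : BraidGroup n) : exponent β⁻¹ = -exponent β := by simp [exponent]

@[simp] theorem exponent_zpow (β : BraidGroup n) (k : ℤ) : exponent (β ^ k) = k * exponent β := by
  simp [exponent]

theorem exponent_sigma {k : ℕ} (h : k < n - 1) : exponent (sigma n k) = 1 := by
  rw [sigma_of_lt h, exponent, expSum, PresentedGroup.toGroup.of]; rfl

theorem exponent_band (p : BandIndex n) : exponent (band p) = 1 := by
  have h := p.2
  have : (p.1.1 : ℕ) < n - 1 := by have := p.1.2.2; omega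
  simp [band, exponent_sigma this]

theorem exponent_descProd {i j : ℕ} (hij : i ≤ j) (hj : j < n) :
    exponent (descProd n i j) = j - i := by
  induction j, hij using Nat.le_induction with
  | base => simp [descProd_of_le]
  | succ j hij ih =>
    rw [descProd_succ hij, exponent_mul, ih (by omega), exponent_sigma (by omega)]
    push_cast; ring

theorem exponent_delta (hn : 1 ≤ n) : exponent (delta n) = n - 1 := by
  rw [delta, exponent_descProd (by omega) (by omega)]; push_cast [hn]; ring

theorem band_mem (p : BandIndex n) : band p ∈ positiveMonoid n :=
  Submonoid.subset_closure ⟨p, rfl⟩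

theorem sigma_mem (k : ℕ) : sigma n k ∈ positiveMonoid n := by
  by_cases h : k < n - 1
  · rw [sigma_eq_natBand]
    exact Submonoid.subset_closure (natBand_mem_range (by omega) (by omega))
  · simp [sigma, h, one_mem]

theorem descProd_mem (i j : ℕ) : descProd n i j ∈ positiveMonoid n := by
  refine Submonoid.list_prod_mem _ fun x hx => ?_
  obtain ⟨k, -, rfl⟩ := List.mem_map.1 hx
  exact sigma_mem k

theorem exponent_nonneg {P : BraidGroup n} (hP : P ∈ positiveMonoid n) : 0 ≤ exponent P := by
  induction hP using Submonoid.closure_induction with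
  | mem x hx => obtain ⟨p, rfl⟩ := hx; simp [exponent_band]
  | one => simp
  | mul x y _ _ hx hy => rw [exponent_mul]; omega

theorem delta_zpow_conj_mem (k : ℤ) {P : BraidGroup n} (hP : P ∈ positiveMonoid n) :
    delta n ^ k * P * (delta n ^ k)⁻¹ ∈ positiveMonoid n := by
  have key : ∀ g : BraidGroup n, (∀ p, g * band p * g⁻¹ ∈ Set.range (band (n := n))) →
      ∀ P ∈ positiveMonoid n, g * P * g⁻¹ ∈ positiveMonoid n := by
    intro g hg P hP
    induction hP using Submonoid.closure_induction with
    | mem x hx => obtain ⟨p, rfl⟩ := hx; exact Submonoid.subset_closure (hg p)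
    | one => simp [one_mem]
    | mul x y _ _ hx hy =>
      have : g * (x * y) * g⁻¹ = (g * x * g⁻¹) * (g * y * g⁻¹) := by group
      rw [this]; exact mul_mem hx hy
  induction k using Int.induction_on generalizing P with
  | zero => simpa using hP
  | succ k ih =>
    have := key _ delta_conj_band _ (ih hP)
    convert this using 1
    rw [add_comm, zpow_add, zpow_one]; group
  | pred k ih =>
    have := key (delta n)⁻¹ (by simpa using delta_inv_conj_band) _ (ih hP)
    convert this using 1
    rw [sub_eq_add_neg, add_comm, zpow_add, zpow_neg_one]; group

/-- Cut `δ` as `U a V` around the band `a`; then `δ = a V (δ⁻¹ U δ)`, and the conjugate of `U` is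
still positive. -/
theorem exists_delta_eq_band_mul (p : BandIndex n) :
    ∃ R ∈ positiveMonoid n, delta n = band p * R := by
  have hp := p.2
  have hp2 := p.1.2.2
  have h : delta n = descProd n p.1.2 (n - 1) * band p *
      (descProd n (p.1.1 + 1) p.1.2 * descProd n 0 p.1.1) := by
    rw [delta, ← descProd_mul (i := 0) (j := p.1.2) (k := n - 1) (by omega) (by omega),
      ← descProd_mul (i := 0) (j := p.1.1 + 1) (k := p.1.2) (by omega) (by omega),
      descProd_succ (i := 0) (by omega), band]
    group
  have hm := mul_mem (mul_mem (descProd_mem (n := n) (p.1.1 + 1) p.1.2) (descProd_mem 0 p.1.1))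
    (delta_zpow_conj_mem (-1) (descProd_mem (n := n) p.1.2 (n - 1)))
  refine ⟨_, hm, ?_⟩
  generalize descProd n p.1.2 (n - 1) = U at *
  generalize descProd n (p.1.1 + 1) p.1.2 * descProd n 0 p.1.1 = V at *
  have h2 : band p * V = U⁻¹ * delta n := by rw [h]; group
  rw [← mul_assoc, h2]; group

theorem exists_delta_eq_mul_band (p : BandIndex n) :
    ∃ L ∈ positiveMonoid n, delta n = L * band p := by
  obtain ⟨R, hR, h⟩ := exists_delta_eq_band_mul p
  refine ⟨_, delta_zpow_conj_mem 1 hR, ?_⟩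
  have h2 : R = (band p)⁻¹ * delta n := by rw [h]; group
  rw [h2]; group

/-! ### The order -/

/-- The left positive factor crosses `δ ^ r` by conjugation, so the two-sided order becomes
one-sided divisibility. -/
theorem delta_zpow_le_iff {r : ℤ} {β : BraidGroup n} :
    r ∈ infSet β ↔ ∃ P ∈ positiveMonoid n, β = delta n ^ r * P := by
  constructor
  · rintro ⟨P, hP, Q, hQ, rfl⟩
    refine ⟨_, mul_mem (delta_zpow_conj_mem (-r) hP) hQ, ?_⟩
    group
  · rintro ⟨P, hP, rfl⟩
    exact ⟨1, one_mem _, P, hP, by simp⟩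

theorem le_delta_zpow_iff {s : ℤ} {β : BraidGroup n} :
    s ∈ supSet β ↔ ∃ P ∈ positiveMonoid n, delta n ^ s = P * β := by
  constructor
  · rintro ⟨P, hP, Q, hQ, h⟩
    refine ⟨_, mul_mem (delta_zpow_conj_mem s hQ) hP, ?_⟩
    have h2 : P * β = delta n ^ s * Q⁻¹ := by rw [h]; group
    rw [mul_assoc, h2]; group
  · rintro ⟨P, hP, h⟩
    exact ⟨P, hP, 1, one_mem _, by simp [h]⟩

/-! ### Negative bands -/

theorem mul_mem_nbSet {α β : BraidGroup n} {k l : ℕ} (hα : k ∈ nbSet α) (hβ : l ∈ nbSet β) :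
    k + l ∈ nbSet (α * β) := by
  obtain ⟨v, rfl, rfl⟩ := hα
  obtain ⟨w, rfl, rfl⟩ := hβ
  exact ⟨v ++ w, by simp [BandWord.eval], by simp [BandWord.negCount]⟩

theorem band_mem_nbSet (p : BandIndex n) : 0 ∈ nbSet (band p) :=
  ⟨[(p, true)], by simp [BandWord.eval], by simp [BandWord.negCount]⟩

theorem band_inv_mem_nbSet (p : BandIndex n) : 1 ∈ nbSet (band p)⁻¹ :=
  ⟨[(p, false)], by simp [BandWord.eval], by simp [BandWord.negCount]⟩

theorem one_mem_nbSet : 0 ∈ nbSet (1 : BraidGroup n) :=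
  ⟨[], by simp [BandWord.eval], by simp [BandWord.negCount]⟩

theorem mem_nbSet_induction {motive : ℕ → BraidGroup n → Prop} (one : motive 0 1)
    (pos : ∀ k β p, motive k β → motive k (band p * β))
    (neg : ∀ k β p, motive k β → motive (k + 1) ((band p)⁻¹ * β))
    {k : ℕ} {β : BraidGroup n} (h : k ∈ nbSet β) : motive k β := by
  obtain ⟨w, rfl, rfl⟩ := h
  induction w with
  | nil => simpa [BandWord.eval, BandWord.negCount] using one
  | cons x w ih =>
    obtain ⟨p, b⟩ := x
    cases b
    · simpa [BandWord.eval, BandWord.negCount] using neg _ _ p ih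
    · simpa [BandWord.eval, BandWord.negCount] using pos _ _ p ih

theorem zero_mem_nbSet {P : BraidGroup n} (hP : P ∈ positiveMonoid n) : 0 ∈ nbSet P := by
  induction hP using Submonoid.closure_induction with
  | mem x hx => obtain ⟨p, rfl⟩ := hx; exact band_mem_nbSet p
  | one => exact one_mem_nbSet
  | mul x y _ _ hx hy => exact mul_mem_nbSet hx hy

/-- The exponent sum is the length of any positive word for `P`, and inverting that word makes all
its letters negative. -/
theorem exponent_mem_nbSet_inv {P : BraidGroup n} (hP : P ∈ positiveMonoid n) :
    (exponent P).toNat ∈ nbSet P⁻¹ := by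
  induction hP using Submonoid.closure_induction with
  | mem x hx => obtain ⟨p, rfl⟩ := hx; simpa [exponent_band] using band_inv_mem_nbSet p
  | one => simpa using one_mem_nbSet
  | mul x y hx' hy' hx hy =>
    rw [mul_inv_rev, exponent_mul, Int.toNat_add (exponent_nonneg hx') (exponent_nonneg hy'),
      add_comm]
    exact mul_mem_nbSet hy hx

theorem nbSet_nonempty (β : BraidGroup n) : (nbSet β).Nonempty := by
  have h : β ∈ Subgroup.closure (Set.range (PresentedGroup.of (rels := artinRels n))) := by
    rw [PresentedGroup.closure_range_of]; trivial
  have hs : ∀ i : Fin (n - 1), sigma n i = PresentedGroup.of i := fun i => sigma_of_lt i.2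
  induction h using Subgroup.closure_induction'' with
  | one => exact ⟨_, one_mem_nbSet⟩
  | mem x hx => obtain ⟨i, rfl⟩ := hx; rw [← hs]; exact ⟨_, zero_mem_nbSet (sigma_mem i)⟩
  | inv_mem x hx =>
    obtain ⟨i, rfl⟩ := hx; rw [← hs]; exact ⟨_, exponent_mem_nbSet_inv (sigma_mem i)⟩
  | mul x y _ _ hx hy => exact ⟨_, mul_mem_nbSet hx.some_mem hy.some_mem⟩

/-- Each negative band is `δ⁻¹ L` with `L` positive, so it costs one factor `δ⁻¹`, which is
collected on the left. -/
theorem neg_mem_infSet {k : ℕ} {β : BraidGroup n} (h : k ∈ nbSet β) : -(k : ℤ) ∈ infSet β := by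
  rw [delta_zpow_le_iff]
  refine mem_nbSet_induction
    (motive := fun k β => ∃ P ∈ positiveMonoid n, β = delta n ^ (-(k : ℤ)) * P) ?_ ?_ ?_ h
  · exact ⟨1, one_mem _, by simp⟩
  · rintro k _ p ⟨P, hP, rfl⟩
    refine ⟨_, mul_mem (delta_zpow_conj_mem (k : ℤ) (band_mem p)) hP, ?_⟩
    group
  · rintro k _ p ⟨P, hP, rfl⟩
    obtain ⟨L, hL, h⟩ := exists_delta_eq_mul_band p
    refine ⟨_, mul_mem (delta_zpow_conj_mem (k : ℤ) hL) hP, ?_⟩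
    have h2 : L = delta n * (band p)⁻¹ := by rw [h]; group
    rw [h2, Nat.cast_succ]; group

theorem neg_le_exponent {k : ℕ} {β : BraidGroup n} (h : k ∈ nbSet β) :
    -(k : ℤ) ≤ exponent β := by
  refine mem_nbSet_induction (motive := fun k β => -(k : ℤ) ≤ exponent β) ?_ ?_ ?_ h
  · simp
  · intro k β p ih; rw [exponent_mul, exponent_band]; omega
  · intro k β p ih; rw [exponent_mul, exponent_inv, exponent_band]; push_cast; omega

/-- A positive braid of length `m` is at most `δ ^ m`. -/
theorem exponent_mem_supSet {P : BraidGroup n} (hP : P ∈ positiveMonoid n) :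
    exponent P ∈ supSet P := by
  rw [le_delta_zpow_iff]
  induction hP using Submonoid.closure_induction with
  | mem x hx =>
    obtain ⟨p, rfl⟩ := hx
    simpa [exponent_band] using exists_delta_eq_mul_band p
  | one => exact ⟨1, one_mem _, by simp⟩
  | mul x y _ _ hx hy =>
    obtain ⟨U, hU, hUx⟩ := hx
    obtain ⟨V, hV, hVy⟩ := hy
    refine ⟨_, mul_mem (delta_zpow_conj_mem (exponent x) hV) hU, ?_⟩
    rw [exponent_mul, zpow_add, hVy, hUx]; group

theorem add_exponent_mem_supSet (r : ℤ) {P : BraidGroup n} (hP : P ∈ positiveMonoid n) :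
    r + exponent P ∈ supSet (delta n ^ r * P) := by
  obtain ⟨U, hU, h⟩ := le_delta_zpow_iff.1 (exponent_mem_supSet hP)
  refine le_delta_zpow_iff.2 ⟨_, delta_zpow_conj_mem r hU, ?_⟩
  rw [zpow_add, h]; group

/-! ### Existence of the extrema and the upper bound -/

theorem isGreatest_braidInf (hn : 2 ≤ n) (β : BraidGroup n) :
    IsGreatest (infSet β) (braidInf β) := by
  have hne : (infSet β).Nonempty := ⟨_, neg_mem_infSet (nbSet_nonempty β).some_mem⟩
  have hb : BddAbove (infSet β) := by
    -- Exponent sums give `r (n - 1) ≤ exponent β`; as `n - 1 ≥ 1`, a positive `r` is at most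
    -- `exponent β`.
    refine ⟨max 0 (exponent β), fun r hr => ?_⟩
    obtain ⟨P, hP, rfl⟩ := delta_zpow_le_iff.1 hr
    have := exponent_nonneg hP
    rw [exponent_mul, exponent_zpow, exponent_delta (by omega)]
    by_contra! hlt
    have h1 : (1 : ℤ) ≤ n - 1 := by omega
    have h2 := max_lt_iff.1 hlt
    nlinarith
  exact ⟨Int.csSup_mem hne hb, fun r hr => le_csSup hb hr⟩

theorem isLeast_braidSup (hn : 2 ≤ n) (β : BraidGroup n) :
    IsLeast (supSet β) (braidSup β) := by
  have hne : (supSet β).Nonempty := by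
    obtain ⟨P, hP, h⟩ := delta_zpow_le_iff.1 (isGreatest_braidInf hn β).1
    have hs := add_exponent_mem_supSet (braidInf β) hP
    rw [← h] at hs
    exact ⟨_, hs⟩
  have hb : BddBelow (supSet β) := by
    refine ⟨min 0 (exponent β), fun s hs => ?_⟩
    obtain ⟨P, hP, h⟩ := le_delta_zpow_iff.1 hs
    have := exponent_nonneg hP
    have he := congrArg exponent h
    rw [exponent_mul, exponent_zpow, exponent_delta (by omega)] at he
    by_contra! hlt
    have h1 : (1 : ℤ) ≤ n - 1 := by omega
    have h2 := lt_min_iff.1 hlt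
    nlinarith
  exact ⟨Int.csInf_mem hne hb, fun s hs => csInf_le hb hs⟩

theorem isLeast_nb (β : BraidGroup n) : IsLeast (nbSet β) (nb β) :=
  ⟨Nat.sInf_mem (nbSet_nonempty β), fun _ hk => Nat.sInf_le hk⟩

/-- Each factor `δ⁻¹` absorbs one band of `P`, which leaves `n - 2` negative bands. -/
theorem exists_mem_nbSet_le (hn : 1 ≤ n) (r : ℕ) {P : BraidGroup n} (hP : P ∈ positiveMonoid n) :
    ∃ k ∈ nbSet (delta n ^ (-(r : ℤ)) * P), (k : ℤ) ≤ r * (n - 1) - min (exponent P) r := by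
  induction r generalizing P with
  | zero =>
    have := exponent_nonneg hP
    exact ⟨0, by simpa using zero_mem_nbSet hP, by simp [this]⟩
  | succ r ih =>
    induction hP using Submonoid.closure_induction_left with
    -- No band is left to absorb: the minimum is `0` and this `δ⁻¹` costs all `n - 1` negative
    -- bands.
    | one =>
      obtain ⟨k, hk, hle⟩ := ih (one_mem (positiveMonoid n))
      have h1 := mul_mem_nbSet (exponent_mem_nbSet_inv (P := delta n) (descProd_mem 0 (n - 1))) hk
      have h2 : (delta n)⁻¹ * (delta n ^ (-(r : ℤ)) * 1) =
          delta n ^ (-((r + 1 : ℕ) : ℤ)) * 1 := by push_cast; group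
      rw [h2] at h1
      refine ⟨_, h1, ?_⟩
      rw [exponent_one, min_eq_left (by positivity)] at hle ⊢
      push_cast
      rw [exponent_delta hn, Int.toNat_of_nonneg (by omega)]
      linarith
    | mul_left x hx y hy _ =>
      obtain ⟨p, rfl⟩ := hx
      obtain ⟨R, hR, hd⟩ := exists_delta_eq_band_mul p
      obtain ⟨k, hk, hle⟩ := ih hy
      have hm := delta_zpow_conj_mem (-(r : ℤ)) hR
      have h1 := mul_mem_nbSet (exponent_mem_nbSet_inv hm) hk
      -- `δ⁻¹ a_p = R⁻¹`, where `R` has length `n - 2`; conjugation by `δ ^ (-r)` moves it to the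
      -- front.
      have h2 : (delta n ^ (-(r : ℤ)) * R * (delta n ^ (-(r : ℤ)))⁻¹)⁻¹ *
          (delta n ^ (-(r : ℤ)) * y) = delta n ^ (-((r + 1 : ℕ) : ℤ)) * (band p * y) := by
        have h3 : R = (band p)⁻¹ * delta n := by rw [hd]; group
        rw [h3]; push_cast; group
      rw [h2] at h1
      refine ⟨_, h1, ?_⟩
      have h3 := congrArg exponent hd
      rw [exponent_mul, exponent_delta hn, exponent_band] at h3
      have h4 := exponent_nonneg hm
      push_cast
      rw [Int.toNat_of_nonneg h4]
      simp only [exponent_mul, exponent_inv, exponent_band]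
      rw [show (1 : ℤ) + exponent y = exponent y + 1 by ring, min_add_add_right]
      linarith

theorem nb_le (hn : 2 ≤ n) {β : BraidGroup n} (h : braidInf β < 0) :
    (nb β : ℤ) ≤ ((n : ℤ) - 2) * |braidInf β| - min 0 (braidSup β) := by
  obtain ⟨P, hP, hβ⟩ := delta_zpow_le_iff.1 (isGreatest_braidInf hn β).1
  obtain ⟨r, hr⟩ : ∃ r : ℕ, braidInf β = -(r : ℤ) := ⟨(-braidInf β).toNat, by omega⟩
  rw [hr] at hβ h ⊢
  obtain ⟨k, hk, hle⟩ := exists_mem_nbSet_le (by omega) r hP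
  rw [← hβ] at hk
  have h1 := (isLeast_nb β).2 hk
  -- `sup(β) ≤ exponent P - r` converts the shortfall `r - min (exponent P) r` into at most `-min 0
  -- (sup β)`.
  have h2 := (isLeast_braidSup hn β).2 (hβ ▸ add_exponent_mem_supSet (-(r : ℤ)) hP)
  rw [abs_neg, Nat.abs_cast]
  have h3 : ((n : ℤ) - 2) * r = r * (n - 1) - r := by ring
  rw [h3]
  omega

end Relations

/-! ### Three strands -/

section ThreeStrands

/-- The bands of `B_3` in cyclic order: `a_i a_{i+1} = δ` for all `i` modulo `3`. -/
def cyclicBand : ZMod 3 → BraidGroup 3 :=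
  ![sigma 3 1, sigma 3 0, sigma 3 1 * sigma 3 0 * (sigma 3 1)⁻¹]

theorem delta_three : delta 3 = sigma 3 1 * sigma 3 0 := by
  simp [delta, descProd, List.range']

theorem cyclicBand_mul_succ (i : ZMod 3) : cyclicBand i * cyclicBand (i + 1) = delta 3 := by
  have h := sigma_braid (n := 3) (i := 0) (by omega)
  rw [delta_three]
  fin_cases i
  · rfl
  · change sigma 3 0 * (sigma 3 1 * sigma 3 0 * (sigma 3 1)⁻¹) = _
    rw [← mul_assoc, ← mul_assoc, h]; group
  · change sigma 3 1 * sigma 3 0 * (sigma 3 1)⁻¹ * sigma 3 1 = _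
    group

theorem band_three (p : BandIndex 3) : ∃ i, band p = cyclicBand i := by
  obtain ⟨⟨i, j⟩, hij⟩ := p
  fin_cases i <;> fin_cases j <;> simp at hij
  · exact ⟨1, by simp [band, descProd, cyclicBand]⟩
  · exact ⟨2, by simp [band, descProd, cyclicBand]⟩
  · exact ⟨0, by simp [band, descProd, cyclicBand]⟩

theorem cyclicBand_mem (i : ZMod 3) : cyclicBand i ∈ positiveMonoid 3 := by
  fin_cases i
  · exact sigma_mem 1
  · exact sigma_mem 0
  · exact band_mem (n := 3) ⟨((0 : Fin 3), (2 : Fin 3)), by decide⟩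

/-- Both sides are `a_i a_{i+1} a_{i+2}`, bracketed in two ways, since `i + 2 = i - 1`. -/
theorem cyclicBand_mul_delta (i : ZMod 3) :
    cyclicBand i * delta 3 = delta 3 * cyclicBand (i - 1) := by
  have h1 := cyclicBand_mul_succ (i + 1)
  have h2 : i + 1 + 1 = i - 1 := by
    rw [add_assoc, sub_eq_add_neg]; rfl
  rw [h2] at h1
  rw [← h1, ← mul_assoc, cyclicBand_mul_succ, h1]

theorem cyclicBand_mul_delta_zpow (i : ZMod 3) (k : ℤ) :
    cyclicBand i * delta 3 ^ k = delta 3 ^ k * cyclicBand (i - k) := by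
  induction k using Int.induction_on with
  | zero => simp
  | succ k ih =>
    rw [zpow_add_one, ← mul_assoc, ih, mul_assoc, cyclicBand_mul_delta, ← mul_assoc]
    push_cast; rw [sub_sub]
  | pred k ih =>
    have h := cyclicBand_mul_delta (i - ((-(k : ℤ) - 1 : ℤ) : ZMod 3))
    rw [show i - ((-(k : ℤ) - 1 : ℤ) : ZMod 3) - 1 = i - ((-(k : ℤ) : ℤ) : ZMod 3) by
      push_cast; ring] at h
    rw [zpow_sub_one, ← mul_assoc, ih, mul_assoc, mul_assoc, mul_right_inj,
      mul_inv_eq_iff_eq_mul, mul_assoc, h, inv_mul_cancel_left]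

/-! ### The action of `B_3` on normal forms -/

/-- Words in the bands of `B_3` without a subword equal to `δ`. -/
abbrev ReducedWord : Type := {l : List (ZMod 3) // l.IsChain fun a b => b ≠ a + 1}

/-- Normal forms in `B_3`: the pair `(k, w)` stands for `δ ^ k w`. -/
abbrev NormalForm : Type := ℤ × ReducedWord

/-- The action on normal forms of left multiplication by the band `a_i`. -/
def mulBand (i : ZMod 3) : NormalForm → NormalForm
  -- Passing `δ ^ k` turns `a_i` into `a_{i-k}`, which either merges with the head of the word into
  -- one more `δ` or is prepended.
  | (k, ⟨[], _⟩) => (k, ⟨[i - k], by simp⟩)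
  | (k, ⟨h :: t, hw⟩) =>
    if hh : h = i - k + 1 then (k + 1, ⟨t, hw.tail⟩)
    else (k, ⟨(i - k) :: h :: t, List.isChain_cons_cons.2 ⟨hh, hw⟩⟩)

/-- The action on normal forms of left multiplication by `δ`. -/
def mulDelta : Equiv.Perm NormalForm := (Equiv.addRight (1 : ℤ)).prodCongr (Equiv.refl _)

theorem mulDelta_apply (k : ℤ) (w : ReducedWord) : mulDelta (k, w) = (k + 1, w) := rfl

theorem mulBand_mulBand_succ (i : ZMod 3) (s : NormalForm) :
    mulBand i (mulBand (i + 1) s) = mulDelta s := by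
  obtain ⟨k, ⟨l, hl⟩⟩ := s
  rw [mulDelta_apply]
  have e1 : i + 1 - (k : ZMod 3) = i - k + 1 := by ring
  cases l with
  | nil => simp [mulBand, e1]
  | cons h t =>
    by_cases hh : h = i + 1 - k + 1
    -- Here `a_{i+1}` merges with `h`; at the raised power of `δ`, `a_i` then restores exactly `h`,
    -- and reducedness of the original word prevents a second merge.
    · have e2 : i - ((k : ZMod 3) + 1) = h := by
        rw [hh]
        have : (3 : ZMod 3) = 0 := rfl
        linear_combination -this
      cases t with
      | nil => simp [mulBand, hh.symm, e2]
      | cons h' t =>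
        have hc := (List.isChain_cons_cons.1 hl).1
        simp [mulBand, hh.symm, e2, hc]
    · rw [e1] at hh
      simp [mulBand, e1, hh]

theorem mulBand_mulDelta (i : ZMod 3) (s : NormalForm) :
    mulBand i (mulDelta s) = mulDelta (mulBand (i - 1) s) := by
  obtain ⟨k, ⟨l, hl⟩⟩ := s
  have e1 : i - ((k : ZMod 3) + 1) = i - 1 - k := by ring
  cases l with
  | nil => simp [mulBand, mulDelta_apply, e1]
  | cons h t =>
    by_cases hh : h = i - 1 - k + 1 <;> simp [mulBand, mulDelta_apply, e1, hh]

/-- `mulBand` as a permutation. -/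
noncomputable def bandPerm (i : ZMod 3) : Equiv.Perm NormalForm :=
  Equiv.ofBijective (mulBand i) ⟨by
    -- Both composites equal the bijection `mulDelta`: as inner factor `mulBand i` is injective, as
    -- outer factor surjective.
    have h : Function.Injective (mulBand (i - 1) ∘ mulBand i) := by
      have : mulBand (i - 1) ∘ mulBand i = mulDelta := by
        funext s
        have := mulBand_mulBand_succ (i - 1) s
        rwa [sub_add_cancel] at this
      rw [this]; exact mulDelta.injective
    exact h.of_comp, by
    have h : Function.Surjective (mulBand i ∘ mulBand (i + 1)) := by
      have : mulBand i ∘ mulBand (i + 1) = mulDelta := funext (mulBand_mulBand_succ i)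
      rw [this]; exact mulDelta.surjective
    exact h.of_comp⟩

theorem bandPerm_mul_succ (i : ZMod 3) : bandPerm i * bandPerm (i + 1) = mulDelta :=
  Equiv.ext (mulBand_mulBand_succ i)

/-- The action of `B_3` on normal forms. -/
noncomputable def normalFormAction : BraidGroup 3 →* Equiv.Perm NormalForm :=
  PresentedGroup.toGroup (f := ![bandPerm 1, bandPerm 0]) (by
    rintro r (⟨i, j, hij, rfl⟩ | ⟨i, j, hij, rfl⟩)
    · omega
    · obtain rfl : i = (0 : Fin 2) := Fin.ext (by have := j.2; change (i : ℕ) = 0; omega)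
      obtain rfl : j = (1 : Fin 2) := Fin.ext hij.symm
      -- The braid relation reads `a_1 (a_0 a_1) = a_1 δ = δ a_0 = (a_0 a_1) a_0`.
      have h1 : bandPerm 0 * bandPerm 1 = mulDelta := bandPerm_mul_succ 0
      have h2 : bandPerm 1 * mulDelta = mulDelta * bandPerm 0 :=
        Equiv.ext (mulBand_mulDelta 1)
      rw [map_mul, map_inv, mul_inv_eq_one]
      simp only [map_mul, FreeGroup.lift_apply_of, Matrix.cons_val_zero, Matrix.cons_val_one]
      rw [mul_assoc, h1, h2])

theorem normalFormAction_cyclicBand (i : ZMod 3) :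
    normalFormAction (cyclicBand i) = bandPerm i := by
  have h0 : normalFormAction (sigma 3 0) = bandPerm 1 := by
    rw [sigma_of_lt (n := 3) (k := 0) (by omega), normalFormAction, PresentedGroup.toGroup.of]; rfl
  have h1 : normalFormAction (sigma 3 1) = bandPerm 0 := by
    rw [sigma_of_lt (n := 3) (k := 1) (by omega), normalFormAction, PresentedGroup.toGroup.of]; rfl
  fin_cases i
  · exact h1
  · exact h0
  · change normalFormAction (sigma 3 1 * sigma 3 0 * (sigma 3 1)⁻¹) = bandPerm 2
    have e1 : bandPerm 0 * bandPerm 1 = mulDelta := bandPerm_mul_succ 0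
    have e2 : bandPerm 2 * bandPerm 0 = mulDelta := bandPerm_mul_succ 2
    rw [map_mul, map_mul, map_inv, h0, h1, mul_inv_eq_iff_eq_mul, e1, e2]

theorem normalFormAction_delta : normalFormAction (delta 3) = mulDelta := by
  rw [← cyclicBand_mul_succ 0, map_mul, normalFormAction_cyclicBand, normalFormAction_cyclicBand,
    bandPerm_mul_succ]

/-- The braid `δ ^ k w` given by a normal form. -/
def NormalForm.eval (s : NormalForm) : BraidGroup 3 :=
  delta 3 ^ s.1 * (s.2.1.map cyclicBand).prod

theorem eval_mulBand (i : ZMod 3) (s : NormalForm) :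
    (mulBand i s).eval = cyclicBand i * s.eval := by
  obtain ⟨k, ⟨l, hl⟩⟩ := s
  cases l with
  | nil => simp [mulBand, NormalForm.eval, cyclicBand_mul_delta_zpow]
  | cons h t =>
    by_cases hh : h = i - k + 1
    · simp only [mulBand, hh, dite_true, NormalForm.eval, List.map_cons, List.prod_cons]
      rw [← mul_assoc, cyclicBand_mul_delta_zpow, mul_assoc, ← mul_assoc (cyclicBand _),
        cyclicBand_mul_succ, zpow_add_one, mul_assoc]
    · simp only [mulBand, hh, dite_false, NormalForm.eval, List.map_cons, List.prod_cons]
      rw [← mul_assoc (cyclicBand i), cyclicBand_mul_delta_zpow, mul_assoc]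

theorem eval_normalFormAction (β : BraidGroup 3) (s : NormalForm) :
    (normalFormAction β s).eval = β * s.eval := by
  obtain ⟨k, hk⟩ := nbSet_nonempty β
  refine mem_nbSet_induction (motive := fun _ β => ∀ s : NormalForm,
    (normalFormAction β s).eval = β * s.eval) ?_ ?_ ?_ hk s
  · simp
  · intro _ β p ih s
    obtain ⟨i, hi⟩ := band_three p
    rw [map_mul, hi, normalFormAction_cyclicBand, mul_assoc, ← ih]
    exact eval_mulBand i _
  · intro _ β p ih s
    obtain ⟨i, hi⟩ := band_three p
    rw [map_mul, map_inv, hi, normalFormAction_cyclicBand, mul_assoc, ← ih,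
      eq_inv_mul_iff_mul_eq, ← eval_mulBand]
    congr 1
    exact (bandPerm i).apply_symm_apply _

/-! ### The lower bound in `B_3` -/

/-- The supremum `k + |w|` of the normal form `(k, w)`. -/
def NormalForm.top (s : NormalForm) : ℤ := s.1 + s.2.1.length

/-- Prepending raises `k + |w|` by one; merging trades one letter for one `δ` and keeps it. -/
theorem top_le_top_mulBand (i : ZMod 3) (s : NormalForm) : s.top ≤ (mulBand i s).top := by
  obtain ⟨k, ⟨l, hl⟩⟩ := s
  cases l with
  | nil => simp [mulBand, NormalForm.top]
  | cons h t =>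
    by_cases hh : h = i - k + 1
    · simp only [mulBand, hh, dite_true, NormalForm.top, List.length_cons]; push_cast; linarith
    · simp only [mulBand, hh, dite_false, NormalForm.top, List.length_cons]; push_cast; linarith

theorem top_le_top_of_mem {P : BraidGroup 3} (hP : P ∈ positiveMonoid 3) (s : NormalForm) :
    s.top ≤ (normalFormAction P s).top := by
  induction hP using Submonoid.closure_induction generalizing s with
  | mem x hx =>
    obtain ⟨p, rfl⟩ := hx
    obtain ⟨i, hi⟩ := band_three p
    rw [hi, normalFormAction_cyclicBand]
    exact top_le_top_mulBand i s
  | one => simp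
  | mul x y _ _ hx hy => rw [map_mul]; exact (hy s).trans (hx _)

theorem mulDelta_zpow_apply (k m : ℤ) (w : ReducedWord) :
    (mulDelta ^ k) (m, w) = (m + k, w) := by
  induction k using Int.induction_on generalizing m with
  | zero => simp
  | succ k ih => rw [zpow_add_one, Equiv.Perm.mul_apply, mulDelta_apply, ih]; congr 1; ring
  | pred k ih =>
    rw [zpow_sub_one, Equiv.Perm.mul_apply,
      show (mulDelta⁻¹ : Equiv.Perm NormalForm) (m, w) = (m - 1, w) from
        Equiv.Perm.inv_eq_iff_eq.2 (by rw [mulDelta_apply, sub_add_cancel]), ih]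
    congr 1; ring

theorem exponent_cyclicBand (i : ZMod 3) : exponent (cyclicBand i) = 1 := by
  have h0 : exponent (sigma 3 0) = 1 := exponent_sigma (by omega)
  have h1 : exponent (sigma 3 1) = 1 := exponent_sigma (by omega)
  fin_cases i
  · exact h1
  · exact h0
  · change exponent (sigma 3 1 * sigma 3 0 * (sigma 3 1)⁻¹) = 1
    simp [h0]

theorem exponent_eval (s : NormalForm) : exponent s.eval = s.1 + s.top := by
  have h : ∀ l : List (ZMod 3), exponent (l.map cyclicBand).prod = l.length := by
    intro l
    induction l with
    | nil => simp
    | cons a l ih =>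
      rw [List.map_cons, List.prod_cons, exponent_mul, ih, exponent_cyclicBand, List.length_cons]
      push_cast; ring
  rw [NormalForm.eval, exponent_mul, exponent_zpow, exponent_delta (by omega), h, NormalForm.top]
  push_cast; ring

/-- A normal form `δ^k w` of `β` has exponent sum `k + (k + |w|)`, with `k ≤ inf(β)` and `k + |w| ≤
sup(β)`. -/
theorem exponent_le_braidInf_add_braidSup (β : BraidGroup 3) :
    exponent β ≤ braidInf β + braidSup β := by
  let o : NormalForm := (0, ⟨[], List.IsChain.nil⟩)
  set s := normalFormAction β o with hs
  have hβ : s.eval = β := by rw [hs, eval_normalFormAction]; simp [o, NormalForm.eval]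
  have h1 : s.1 ≤ braidInf β := by
    refine (isGreatest_braidInf (by omega) β).2 (delta_zpow_le_iff.2 ⟨_, ?_, hβ.symm⟩)
    refine Submonoid.list_prod_mem _ fun x hx => ?_
    obtain ⟨i, -, rfl⟩ := List.mem_map.1 hx
    exact cyclicBand_mem i
  have h2 : s.top ≤ braidSup β := by
    -- With `s` the normal form of `β`, the positive `P` carries `s` to the normal form of `P β = δ
    -- ^ sup(β)`, whose top is `sup(β)`.
    obtain ⟨P, hP, h⟩ := le_delta_zpow_iff.1 (isLeast_braidSup (by omega) β).1
    have h3 := top_le_top_of_mem hP s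
    rw [hs, ← Equiv.Perm.mul_apply, ← map_mul, ← h, map_zpow, normalFormAction_delta,
      mulDelta_zpow_apply] at h3
    simpa [NormalForm.top] using h3
  have h3 := exponent_eval s
  rw [hβ] at h3
  omega

theorem nb_eq_of_three {β : BraidGroup 3} (h : braidInf β < 0) :
    (nb β : ℤ) = |braidInf β| - min 0 (braidSup β) := by
  have h1 := nb_le (by omega) h
  have h2 := (isGreatest_braidInf (by omega) β).2 (neg_mem_infSet (isLeast_nb β).1)
  have h3 := neg_le_exponent (isLeast_nb β).1
  have h4 := exponent_le_braidInf_add_braidSup β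
  rw [abs_of_neg h] at h1 ⊢
  push_cast at h1
  omega

end ThreeStrands

end BKL

theorem theorem8p6 (n : ℕ) (hn : 2 ≤ n) (β : BKL.BraidGroup n) :
    -- the extrema in the definitions of `inf(β)`, `sup(β)`, `nb(β)` are attained
    IsGreatest (BKL.infSet β) (BKL.braidInf β) ∧
    IsLeast (BKL.supSet β) (BKL.braidSup β) ∧
    IsLeast (BKL.nbSet β) (BKL.nb β) ∧
    -- the upper bound
    (BKL.braidInf β < 0 →
      (BKL.nb β : ℤ) ≤ ((n : ℤ) - 2) * |BKL.braidInf β| - min 0 (BKL.braidSup β)) ∧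
    -- equality for three strands
    (n = 3 → BKL.braidInf β < 0 →
      (BKL.nb β : ℤ) = |BKL.braidInf β| - min 0 (BKL.braidSup β)) := by
  refine ⟨BKL.isGreatest_braidInf hn β, BKL.isLeast_braidSup hn β, BKL.isLeast_nb β,
    BKL.nb_le hn, ?_⟩
  rintro rfl
  exact BKL.nb_eq_of_three
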